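/- Let $A$ be a finite alphabet. A stationary process $\mathcal P=(X_t)_{t\in\mathbb Z}$ over $A$ has past $\overleftarrow{X}=\dots X_{-2}X_{-1}$ and future $\overrightarrow{X}=X_0X_1\dots$; its time reversal $\mathcal P^-$ is the law of $Y_t=X_{-(t+1)}$. The causal states of $\mathcal P$ are the classes of pasts under $\overleftarrow{x}\sim\overleftarrow{x}'\iff P(\overrightarrow{X}\mid\overleftarrow{X}=\overleftarrow{x})=P(\overrightarrow{X}\mid\overleftarrow{X}=\overleftarrow{x}')$ (counted up to null sets of pasts), and the classical topological complexity $D_\mu(\mathcal P)$ is the logarithm of their number. A quantum model of $\mathcal P$ on a $d$-dimensional system consists of a measurable encoding $\overleftarrow{x}\mapsto|s_{\overleftarrow{x}}\rangle\in\mathbb C^d$ of pasts into unit vectors and a quantum instrument $\mathcal M$ on $\mathbb C^d$ with outcomes in $A$ such that, for almost every past $\overleftarrow{x}$, applying $\mathcal M$ to $|s_{\overleftarrow{x}}\rangle$ gives each outcome $a$ with probability $P(X_0=a\mid\overleftarrow{X}=\overleftarrow{x})$ and, when $a$ occurs, leaves the system in the state $|s_{\overleftarrow{x}a}\rangle$ (up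 to phase). The quantum topological complexity $D_q(\mathcal P)$ is the logarithm of the minimal $d$ for which such a model exists. For $0<p,q<1$ the perturbed coin is the stationary Markov chain on $\{0,1\}$ that flips with probability $p$ when in $0$ and with probability $q$ when in $1$. The heralding coin $\mathcal P_h$ is obtained from it by replacing the first $0$ of each consecutive substring of $0$s by a $2$. Then $D_q$ can be strictly less than $D_\mu$: for all $0<p,q<1$ the perturbed coin exists and its law is unique; the reversed heralding coin $\mathcal P_h^-$ has exactly $3$ causal states but has a quantum model on a single qubit ($d=2$); and $$D_q(\mathcal P_h^-)=\log 2<\log 3=D_\mu(\mathcal P_h^-).$$ -/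

import Mathlib

open MeasureTheory ProbabilityTheory
open scoped ENNReal ComplexConjugate

noncomputable section

namespace CausalModelling

/-! ### Stationary stochastic processes and time reversal -/

/-- The shift by one time-step on bi-infinite sequences of outputs. -/
def shift {A : Type*} (x : ℤ → A) : ℤ → A := fun t => x (t + 1)

/-- A stationary stochastic process `(X_t)_{t ∈ ℤ}` with values in `A`, given by its joint law on
bi-infinite sequences of outputs. -/
@[ext]
structure StationaryProcess (A : Type*) [MeasurableSpace A] where
  /-- the joint law of `(X_t)_{t ∈ ℤ}` -/
  law : Measure (ℤ → A)
  isProbability : IsProbabilityMeasure law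
  stationary : law.map shift = law

attribute [instance] StationaryProcess.isProbability

section Reversal

variable {A : Type*} [MeasurableSpace A]

theorem measurable_shift : Measurable (shift : (ℤ → A) → ℤ → A) :=
  measurable_pi_lambda _ fun t => measurable_pi_apply (t + 1)

/-- Reading a bi-infinite sequence from right to left: `Y_t = X_{-(t+1)}`. -/
def reversal (x : ℤ → A) : ℤ → A := fun t => x (-(t + 1))

theorem measurable_reversal : Measurable (reversal : (ℤ → A) → ℤ → A) :=
  measurable_pi_lambda _ fun t => measurable_pi_apply (-(t + 1))

/-- The time reversal `P⁻` of a process: the law of `Y_t = X_{-(t+1)}`. -/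
def StationaryProcess.reverse (P : StationaryProcess A) : StationaryProcess A where
  law := P.law.map reversal
  isProbability := Measure.isProbabilityMeasure_map measurable_reversal.aemeasurable
  stationary := by
    have h : (shift ∘ reversal) ∘ shift = (reversal : (ℤ → A) → ℤ → A) := by
      funext x t
      simp only [Function.comp_apply, shift, reversal]
      congr 1
      ring
    rw [Measure.map_map measurable_shift measurable_reversal]
    conv_lhs => rw [← P.stationary]
    rw [Measure.map_map (measurable_shift.comp measurable_reversal) measurable_shift, h]

/-- The past `… x₋₂ x₋₁` of a sequence; index `n` carries `x_{-(n+1)}`, so that index `0` is the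
most recent output. -/
def past (x : ℤ → A) : ℕ → A := fun n => x (-((n : ℤ) + 1))

/-- The future `x₀ x₁ …` of a sequence. -/
def future (x : ℤ → A) : ℕ → A := fun n => x (n : ℤ)

/-- The law of the past. -/
def StationaryProcess.pastLaw (P : StationaryProcess A) : Measure (ℕ → A) := P.law.map past

/-- The past `… x₋₂ x₋₁ a` obtained by appending the new output `a` to a past. -/
def appendOutput (x : ℕ → A) (a : A) : ℕ → A
  | 0 => a
  | n + 1 => x n

end Reversal

section Models

variable {A : Type*} [Fintype A] [Nonempty A] [MeasurableSpace A] [DiscreteMeasurableSpace A]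

/-- The conditional law `P(future | past = x)` (a regular conditional distribution). -/
def StationaryProcess.futureGivenPast (P : StationaryProcess A) : Kernel (ℕ → A) (ℕ → A) :=
  condDistrib future past P.law

/-- The probability `P(X₀ = a | past = x)`. -/
def StationaryProcess.nextProb (P : StationaryProcess A) (x : ℕ → A) (a : A) : ℝ :=
  (P.futureGivenPast x).real {y | y 0 = a}

/-! ### Causal states and the classical topological state complexity -/

/-- Two pasts are equivalent when they have coinciding conditional futures. -/
def StationaryProcess.causalSetoid (P : StationaryProcess A) : Setoid (ℕ → A) :=
  Setoid.ker fun x => P.futureGivenPast x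

/-- A causal state is an equivalence class of pasts. -/
def StationaryProcess.CausalState (P : StationaryProcess A) : Type _ :=
  Quotient P.causalSetoid

/-- The encoding function that sends a past to its causal state. -/
def StationaryProcess.causalState (P : StationaryProcess A) (x : ℕ → A) : P.CausalState :=
  Quotient.mk P.causalSetoid x

/-- The number of causal states of a process. Conditional distributions are only determined up to
null sets of pasts, so we count the causal states of the pasts in a set of full probability, for
the best such set. -/
def StationaryProcess.numCausalStates (P : StationaryProcess A) : ℕ∞ :=
  ⨅ (S : Set (ℕ → A)) (_ : ∀ᵐ x ∂P.pastLaw, x ∈ S), (P.causalState '' S).encard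

/-- The classical topological state complexity `D_μ`: the logarithm of the number of causal
states (`⊤` if there are infinitely many). -/
def StationaryProcess.topologicalComplexity (P : StationaryProcess A) : EReal :=
  ENNReal.log (P.numCausalStates : ℝ≥0∞)

/-! ### Quantum models and the quantum topological complexity -/

/-- The rank-one operator `|ψ⟩⟨ψ|`. -/
def ketbra {d : ℕ} (ψ : EuclideanSpace ℂ (Fin d)) : Matrix (Fin d) (Fin d) ℂ :=
  Matrix.of fun i j => ψ i * conj (ψ j)

/-- A quantum measurement process with outcomes in `A` on a `d`-dimensional system (a quantum
instrument), in Kraus form. -/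
structure QuantumInstrument (A : Type*) [Fintype A] (d : ℕ) where
  /-- number of Kraus operators per outcome -/
  r : ℕ
  kraus : A → Fin r → Matrix (Fin d) (Fin d) ℂ
  complete : ∑ a, ∑ k, (kraus a k).conjTranspose * kraus a k = 1

/-- The unnormalised state of the system after outcome `a` was observed; its trace is the
probability of that outcome. -/
def QuantumInstrument.apply {d : ℕ} (M : QuantumInstrument A d) (a : A)
    (ρ : Matrix (Fin d) (Fin d) ℂ) : Matrix (Fin d) (Fin d) ℂ :=
  ∑ k, M.kraus a k * ρ * (M.kraus a k).conjTranspose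

/-- A quantum causal model of the process `P` on a `d`-dimensional system: an encoding of pasts
into pure states, with a quantum measurement process that, for almost every past `x`, outputs `a`
with probability `P(X₀ = a | past = x)` and leaves the system in the state that encodes the
updated past `x a`. -/
structure QuantumModel (P : StationaryProcess A) (d : ℕ) where
  encode : (ℕ → A) → EuclideanSpace ℂ (Fin d)
  measurable_encode : Measurable encode
  norm_encode : ∀ x, ‖encode x‖ = 1
  measurement : QuantumInstrument A d
  output : ∀ᵐ x ∂P.pastLaw, ∀ a,
    (measurement.apply a (ketbra (encode x))).trace = (P.nextProb x a : ℂ)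
  update : ∀ᵐ x ∂P.pastLaw, ∀ a,
    measurement.apply a (ketbra (encode x)) =
      (measurement.apply a (ketbra (encode x))).trace • ketbra (encode (appendOutput x a))

/-- The minimal dimension of a quantum system that models the process (`⊤` if there is none of
finite dimension). -/
def StationaryProcess.minQuantumDim (P : StationaryProcess A) : ℕ∞ :=
  ⨅ (d : ℕ) (_ : Nonempty (QuantumModel P d)), (d : ℕ∞)

/-- The quantum topological complexity `D_q`: the logarithm of the minimal dimension of a quantum
system that models the process. -/
def StationaryProcess.quantumTopologicalComplexity (P : StationaryProcess A) : EReal :=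
  ENNReal.log (P.minQuantumDim : ℝ≥0∞)

end Models

/-! ### The perturbed coin and the heralding coin -/

/-- Transition probabilities of the perturbed coin: it flips with probability `p` in heads (`0`)
and with probability `q` in tails (`1`). -/
def coinStep (p q : ℝ) (i j : Fin 2) : ℝ :=
  if i = 0 then (if j = 1 then p else 1 - p) else (if j = 0 then q else 1 - q)

/-- Stationary distribution of the perturbed coin. -/
def coinStationary (p q : ℝ) (i : Fin 2) : ℝ :=
  if i = 0 then q / (p + q) else p / (p + q)

/-- `C` is the perturbed coin: the stationary two-state Markov chain with the above transition
probabilities, given by the probabilities of all finite words `w₀ … wₙ` at times `t, …, t + n`. -/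
def IsPerturbedCoin (p q : ℝ) (C : StationaryProcess (Fin 2)) : Prop :=
  ∀ (t : ℤ) (n : ℕ) (w : Fin (n + 1) → Fin 2),
    C.law {c | ∀ i : Fin (n + 1), c (t + (i : ℕ)) = w i} =
      ENNReal.ofReal
        (coinStationary p q (w 0) * ∏ i : Fin n, coinStep p q (w i.castSucc) (w i.succ))

/-- Replace the first `0` of each consecutive substring of `0`s by a `2`. -/
def heraldMap (c : ℤ → Fin 2) : ℤ → Fin 3 := fun t =>
  if c t = 1 then 1 else if c (t - 1) = 1 then 2 else 0

theorem measurable_heraldMap : Measurable heraldMap := by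
  refine measurable_pi_lambda _ fun t => ?_
  have h : (fun c : ℤ → Fin 2 => heraldMap c t) =
      (fun ab : Fin 2 × Fin 2 => if ab.1 = 1 then (1 : Fin 3) else if ab.2 = 1 then 2 else 0) ∘
        fun c => (c t, c (t - 1)) := rfl
  rw [h]
  exact (Measurable.of_discrete).comp
    ((measurable_pi_apply t).prodMk (measurable_pi_apply (t - 1)))

/-- The process obtained from a coin process by replacing the first `0` of each substring of `0`s
by a `2`; applied to the perturbed coin, this is the heralding coin. -/
def herald (C : StationaryProcess (Fin 2)) : StationaryProcess (Fin 3) where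
  law := C.law.map heraldMap
  isProbability := Measure.isProbabilityMeasure_map measurable_heraldMap.aemeasurable
  stationary := by
    have h : shift ∘ heraldMap = heraldMap ∘ shift := by
      funext c t
      have e : t - 1 + 1 = t + 1 - 1 := by ring
      simp only [Function.comp_apply, shift, heraldMap, e]
    rw [Measure.map_map measurable_shift measurable_heraldMap, h,
      ← Measure.map_map measurable_heraldMap measurable_shift, C.stationary]

end CausalModelling

end

/-! The perturbed coin is built by coupling from the past. Independent random maps `u t` of the two
states drive the chain. The constant map `0` has positive probability, so almost surely it occurs
before every time, and from then on all trajectories agree. The limit trajectory `coupled` commutes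
with the shift and is adapted to the maps, so its law is stationary with the right word
probabilities (`noiseLaw_coupled_word`). These determine the process (`IsPerturbedCoin.unique`), so
any property may be proved on this realisation. In particular, given the present, the continuation
is a function of later maps and so independent of the history (`IsPerturbedCoin.markov`).

The past of the reversed heralding coin is read off the coin from time `0` on, except that its last
output also looks at time `-1`. Hence the last output screens off the past from the future
(`IsPerturbedCoin.reverse_herald_markov`), and the process is a Markov chain with matrix
`reverseStep`. The entries `0`, `1 - q`, `1` of its column `1` differ, which gives three causal
states.

Row `1` of the matrix is `q` times row `0` plus `1 - q` times row `2`. So the state for `1` can be a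
superposition of the two orthogonal states for `0` and `2`: measuring in that basis, then preparing
the state of the outcome, gives a qubit model. Dimension below `2` would make the next-output
probabilities independent of the past (`two_le_of_quantumModel`). -/

noncomputable section

namespace CausalModelling

open Filter

/-! ### A random-map realisation of the perturbed coin -/

/-- The law of the next symbol of the perturbed coin in state `i`. -/
def stepLaw (p q : ℝ) (i : Fin 2) : Measure (Fin 2) :=
  ∑ j, ENNReal.ofReal (coinStep p q i j) • Measure.dirac j

theorem stepLaw_singleton (p q : ℝ) (i j : Fin 2) :
    stepLaw p q i {j} = ENNReal.ofReal (coinStep p q i j) := by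
  fin_cases j <;> simp [stepLaw]

/-- Flip probabilities strictly between `0` and `1`. -/
class IsNondegenerate (p q : ℝ) : Prop where
  p_pos : 0 < p
  p_lt : p < 1
  q_pos : 0 < q
  q_lt : q < 1

theorem coinStep_nonneg (p q : ℝ) [h : IsNondegenerate p q] (i j : Fin 2) :
    0 ≤ coinStep p q i j := by
  obtain ⟨_, _, _, _⟩ := h
  unfold coinStep
  split_ifs <;> linarith

instance isProbabilityMeasure_stepLaw (p q : ℝ) [IsNondegenerate p q] (i : Fin 2) :
    IsProbabilityMeasure (stepLaw p q i) := by
  constructor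
  have : stepLaw p q i Set.univ = ENNReal.ofReal (∑ j, coinStep p q i j) := by
    rw [ENNReal.ofReal_sum_of_nonneg fun j _ => coinStep_nonneg p q i j]
    simp [stepLaw]
  rw [this]
  fin_cases i <;> simp [coinStep]

/-- The law of a random update map whose values at the two states are independent. -/
def mapLaw (p q : ℝ) : Measure (Fin 2 → Fin 2) := Measure.pi (stepLaw p q)

instance isProbabilityMeasure_mapLaw (p q : ℝ) [IsNondegenerate p q] :
    IsProbabilityMeasure (mapLaw p q) := by
  unfold mapLaw
  infer_instance

/-- The law of a bi-infinite sequence of independent random update maps. -/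
def noiseLaw (p q : ℝ) : Measure (ℤ → Fin 2 → Fin 2) := Measure.infinitePi fun _ => mapLaw p q

instance isProbabilityMeasure_noiseLaw (p q : ℝ) [IsNondegenerate p q] :
    IsProbabilityMeasure (noiseLaw p q) := by
  unfold noiseLaw
  infer_instance

/-- The state at time `t` of the trajectory driven by `u` that starts from `0` at time `t - n`. -/
def runFrom (u : ℤ → Fin 2 → Fin 2) : ℕ → ℤ → Fin 2
  | 0, _ => 0
  | n + 1, t => u t (runFrom u n (t - 1))

open Classical in
/-- The trajectory driven by `u` that was started in the infinite past. -/
def coupled (u : ℤ → Fin 2 → Fin 2) (t : ℤ) : Fin 2 :=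
  if ∀ᶠ n in atTop, runFrom u n t = 1 then 1 else 0

/-! ### Coalescence of trajectories -/

theorem runFrom_shift (u : ℤ → Fin 2 → Fin 2) (n : ℕ) (t : ℤ) :
    runFrom (shift u) n t = runFrom u n (t + 1) := by
  induction n generalizing t with
  | zero => rfl
  | succ n ih =>
    have e : t - 1 + 1 = t + 1 - 1 := by ring
    simp only [runFrom, ih, shift, e]

open Classical in
theorem coupled_shift (u : ℤ → Fin 2 → Fin 2) : coupled (shift u) = shift (coupled u) := by
  funext t
  unfold coupled
  exact if_congr (by simp only [runFrom_shift]) rfl rfl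

/-- A constant map erases everything before it; a run of `n` steps ending at `t` uses the map at
time `t - k` exactly when `k < n`. -/
theorem runFrom_eq_of_const {u : ℤ → Fin 2 → Fin 2} {k : ℕ} {t : ℤ} (h : u (t - k) = 0) {n : ℕ}
    (hn : k < n) : runFrom u n t = runFrom u (k + 1) t := by
  induction k generalizing t n with
  | zero =>
    obtain ⟨n, rfl⟩ := Nat.exists_eq_succ_of_ne_zero hn.ne'
    simp only [Nat.cast_zero, sub_zero] at h
    simp [runFrom, h]
  | succ k ih =>
    obtain ⟨n, rfl⟩ := Nat.exists_eq_succ_of_ne_zero (Nat.ne_zero_of_lt hn)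
    have e : t - 1 - (k : ℤ) = t - ((k + 1 : ℕ) : ℤ) := by push_cast; ring
    rw [runFrom, ih (by rwa [e]) (by omega)]
    rfl

theorem coupled_eq_of_eventually {u : ℤ → Fin 2 → Fin 2} {t : ℤ} {v : Fin 2}
    (h : ∀ᶠ n in atTop, runFrom u n t = v) : coupled u t = v := by
  unfold coupled
  split_ifs with h'
  · obtain ⟨n, h1, h2⟩ := (h.and h').exists
    exact h2.symm.trans h1
  · by_contra hv
    refine h' (h.mono fun n hn => ?_)
    omega

theorem coupled_step {u : ℤ → Fin 2 → Fin 2} {t : ℤ} (h : ∃ k : ℕ, u (t - 1 - k) = 0) :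
    coupled u t = u t (coupled u (t - 1)) := by
  obtain ⟨k, hk⟩ := h
  have h1 : ∀ᶠ n in atTop, runFrom u n (t - 1) = runFrom u (k + 1) (t - 1) :=
    (eventually_gt_atTop k).mono fun n hn => runFrom_eq_of_const hk hn
  rw [coupled_eq_of_eventually h1]
  apply coupled_eq_of_eventually
  -- An `n`-step run to `t` passes through the `(n - 1)`-step run to `t - 1`.
  filter_upwards [(tendsto_sub_atTop_nat 1).eventually h1, eventually_ge_atTop 1] with n hn hn1
  obtain ⟨n, rfl⟩ := Nat.exists_eq_add_of_le' hn1
  rw [runFrom, ← hn]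
  rfl

/-- The information carried by the update maps at the times in `s`. -/
@[reducible]
def timesAlgebra (s : Set ℤ) : MeasurableSpace (ℤ → Fin 2 → Fin 2) :=
  ⨆ i ∈ s, MeasurableSpace.comap (fun u => u i) inferInstance

theorem measurable_eval_timesAlgebra {s : Set ℤ} {i : ℤ} (hi : i ∈ s) :
    Measurable[timesAlgebra s] fun u : ℤ → Fin 2 → Fin 2 => u i :=
  Measurable.of_comap_le
    (le_iSup₂ (f := fun (i : ℤ) (_ : i ∈ s) => MeasurableSpace.comap
      (fun u : ℤ → Fin 2 → Fin 2 => u i) inferInstance) i hi)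

theorem timesAlgebra_le (s : Set ℤ) :
    timesAlgebra s ≤ (inferInstance : MeasurableSpace (ℤ → Fin 2 → Fin 2)) :=
  iSup₂_le fun i _ => (measurable_pi_apply i).comap_le

theorem measurable_apply_timesAlgebra {s : Set ℤ} {i : ℤ} (hi : i ∈ s)
    {f : (ℤ → Fin 2 → Fin 2) → Fin 2} (hf : Measurable[timesAlgebra s] f) :
    Measurable[timesAlgebra s] fun u : ℤ → Fin 2 → Fin 2 => u i (f u) :=
  (Measurable.of_discrete (f := fun z : (Fin 2 → Fin 2) × Fin 2 => z.1 z.2)).comp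
    ((measurable_eval_timesAlgebra hi).prodMk hf)

theorem measurable_runFrom {s : Set ℤ} {t : ℤ} (hs : Set.Iic t ⊆ s) (n : ℕ) :
    Measurable[timesAlgebra s] fun u => runFrom u n t := by
  induction n generalizing t with
  | zero => exact measurable_const
  | succ n ih =>
    exact measurable_apply_timesAlgebra (hs (Set.mem_Iic.2 le_rfl))
      (ih ((Set.Iic_subset_Iic.2 (by omega)).trans hs))

theorem measurable_coupled_timesAlgebra {s : Set ℤ} {t : ℤ} (hs : Set.Iic t ⊆ s) :
    Measurable[timesAlgebra s] fun u => coupled u t := by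
  refine Measurable.ite ?_ measurable_const measurable_const
  simp only [eventually_atTop, Set.ofPred_exists, Set.ofPred_forall]
  exact MeasurableSet.iUnion fun N => MeasurableSet.iInter fun n => MeasurableSet.iInter fun _ =>
    measurable_runFrom hs n (measurableSet_singleton 1)

theorem measurable_coupled : Measurable coupled :=
  measurable_pi_lambda _ fun _ =>
    (measurable_coupled_timesAlgebra (Set.subset_univ _)).mono (timesAlgebra_le _) le_rfl

/-- The trajectory from time `0` on driven by `u` that starts in state `j` at time `0`. -/
def runAhead (u : ℤ → Fin 2 → Fin 2) (j : Fin 2) : ℕ → Fin 2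
  | 0 => j
  | n + 1 => u (n + 1 : ℕ) (runAhead u j n)

theorem measurable_runAhead (j : Fin 2) :
    Measurable[timesAlgebra (Set.Ioi 0)] fun u => runAhead u j := by
  refine @measurable_pi_lambda _ _ _ (timesAlgebra (Set.Ioi 0)) _ _ fun n => ?_
  induction n with
  | zero => exact measurable_const
  | succ n ih => exact measurable_apply_timesAlgebra (Set.mem_Ioi.2 (by positivity)) ih

/-- Every finite set of times lies in a window `[-N, N]`, whose joint law is fixed by the word
probabilities, and finite marginals determine a law on sequences. -/
theorem IsPerturbedCoin.unique {p q : ℝ} {C D : StationaryProcess (Fin 2)} (hC : IsPerturbedCoin p q C)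
    (hD : IsPerturbedCoin p q D) : C = D := by
  refine StationaryProcess.ext ?_
  refine IsProjectiveLimit.unique (P := fun I => C.law.map I.restrict) (fun I => rfl) fun I => ?_
  obtain ⟨N, hN⟩ : ∃ N : ℕ, ∀ i ∈ I, -(N : ℤ) ≤ i ∧ i ≤ N := by
    refine ⟨I.sup Int.natAbs, fun i hi => ?_⟩
    have := Finset.le_sup (f := Int.natAbs) hi
    omega
  let r : (ℤ → Fin 2) → Fin (2 * N + 1) → Fin 2 := fun c i => c (-(N : ℤ) + (i : ℕ))
  have hr : Measurable r := measurable_pi_lambda _ fun i => measurable_pi_apply _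
  have hDC : D.law.map r = C.law.map r := by
    refine Measure.ext_of_singleton fun w => ?_
    have e : r ⁻¹' {w} = {c | ∀ i : Fin (2 * N + 1), c (-(N : ℤ) + (i : ℕ)) = w i} := by
      ext c
      exact funext_iff
    rw [Measure.map_apply hr (measurableSet_singleton _),
      Measure.map_apply hr (measurableSet_singleton _), e, hC, hD]
  let g : (Fin (2 * N + 1) → Fin 2) → I → Fin 2 := fun w i =>
    w ⟨((i : ℤ) + N).toNat, by have := hN i i.2; omega⟩
  have hg : (I.restrict : (ℤ → Fin 2) → I → Fin 2) = g ∘ r := by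
    funext c i
    have := hN i i.2
    simp only [Finset.restrict, Function.comp_apply, g, r]
    congr 1
    omega
  have hgm : Measurable g := .of_discrete
  change D.law.map I.restrict = C.law.map I.restrict
  rw [hg, ← Measure.map_map hgm hr, ← Measure.map_map hgm hr, hDC]

/-! ### The law of the coupled trajectory -/

section Noise

variable (p q : ℝ) [hpq : IsNondegenerate p q]

theorem noiseLaw_map_shift : (noiseLaw p q).map shift = noiseLaw p q := by
  refine Measure.eq_infinitePi _ fun s t ht => ?_
  have h : shift ⁻¹' (Set.pi s t) =
      Set.pi (s.map (Equiv.addRight (1 : ℤ)).toEmbedding : Finset ℤ) fun i => t (i - 1) := by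
    ext u
    simp only [Set.mem_preimage, Set.mem_pi, shift, Finset.coe_map, Set.forall_mem_image]
    simp
  rw [Measure.map_apply measurable_shift (.pi s.countable_toSet fun i _ => ht i), h, noiseLaw,
    Measure.infinitePi_pi _ fun i _ => ht _]
  simp

theorem mapLaw_apply_eq (i j : Fin 2) :
    mapLaw p q {g | g i = j} = ENNReal.ofReal (coinStep p q i j) := by
  have h := (measurePreserving_eval (stepLaw p q) i).measure_preimage
    (measurableSet_singleton j).nullMeasurableSet
  rw [← stepLaw_singleton, ← h]
  rfl

theorem noiseLaw_preimage_eval (t : ℤ) {S : Set (Fin 2 → Fin 2)} (hS : MeasurableSet S) :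
    noiseLaw p q {u | u t ∈ S} = mapLaw p q S :=
  (measurePreserving_eval_infinitePi (fun _ : ℤ => mapLaw p q) t).measure_preimage
    hS.nullMeasurableSet

/-- Here `0` is the constant map, which has mass `(1 - p) * q`. -/
theorem mapLaw_zero_pos : 0 < mapLaw p q {0} := by
  have := hpq.p_lt
  have := hpq.q_pos
  rw [mapLaw, Measure.pi_singleton]
  simp only [Pi.zero_apply, stepLaw_singleton, Fin.prod_univ_two]
  refine ENNReal.mul_pos ?_ ?_ <;> simp [coinStep] <;> linarith

theorem ae_exists_const (t : ℤ) : ∀ᵐ u ∂noiseLaw p q, ∃ k : ℕ, u (t - k) = 0 := by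
  have hlt : mapLaw p q {0}ᶜ < 1 := by
    rw [prob_compl_eq_one_sub (measurableSet_singleton _)]
    exact ENNReal.sub_lt_self ENNReal.one_ne_top one_ne_zero (mapLaw_zero_pos p q).ne'
  -- By independence, `n` consecutive times avoid the constant map with probability the `n`-th power
  -- of a number below `1`.
  refine le_antisymm (ge_of_tendsto' (ENNReal.tendsto_pow_atTop_nhds_zero_of_lt_one hlt)
    fun n => ?_) zero_le
  let e : ℕ ↪ ℤ := ⟨fun k => t - k, fun a b h => by simpa using h⟩
  calc _ ≤ noiseLaw p q (Set.pi ((Finset.range n).map e : Finset ℤ) fun _ => {0}ᶜ) := by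
        refine measure_mono fun u hu => ?_
        simp only [not_exists, Set.mem_compl_iff, Set.mem_ofPred_eq] at hu
        simp only [Set.mem_pi, Finset.coe_map, Set.forall_mem_image]
        exact fun k _ => hu k
    _ = _ := by
        rw [noiseLaw, Measure.infinitePi_pi _ fun i _ => (measurableSet_singleton _).compl]
        simp

theorem ae_coupled_step : ∀ᵐ u ∂noiseLaw p q, ∀ t, coupled u t = u t (coupled u (t - 1)) :=
  ae_all_iff.2 fun t => (ae_exists_const p q (t - 1)).mono fun _ h => coupled_step h

theorem ae_coupled_runAhead :
    ∀ᵐ u ∂noiseLaw p q, ∀ n : ℕ, coupled u n = runAhead u (coupled u 0) n := by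
  filter_upwards [ae_coupled_step p q] with u hu n
  induction n with
  | zero => rfl
  | succ n ih =>
    rw [hu, runAhead, ← ih]
    simp

theorem indep_timesAlgebra {s t : Set ℤ} (h : Disjoint s t) :
    Indep (timesAlgebra s) (timesAlgebra t) (noiseLaw p q) :=
  indep_iSup_of_disjoint (fun i => (measurable_pi_apply i).comap_le)
    (iIndepFun_infinitePi (P := fun _ : ℤ => mapLaw p q) (X := fun _ g => g)
      fun _ => measurable_id) h

theorem noiseLaw_inter {s t : Set ℤ} (h : Disjoint s t) {S T : Set (ℤ → Fin 2 → Fin 2)}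
    (hS : MeasurableSet[timesAlgebra s] S) (hT : MeasurableSet[timesAlgebra t] T) :
    noiseLaw p q (S ∩ T) = noiseLaw p q S * noiseLaw p q T :=
  (Indep_iff _ _ _).1 (indep_timesAlgebra p q h) S T hS hT

theorem noiseLaw_coupled_shift (t : ℤ) (i : Fin 2) :
    noiseLaw p q {u | coupled u t = i} = noiseLaw p q {u | coupled u (t - 1) = i} := by
  have hm : MeasurableSet {u : ℤ → Fin 2 → Fin 2 | coupled u (t - 1) = i} :=
    (measurable_pi_apply (t - 1)).comp measurable_coupled (measurableSet_singleton i)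
  conv_rhs => rw [← noiseLaw_map_shift p q, Measure.map_apply measurable_shift hm]
  simp [coupled_shift, shift]

/-- One step of the chain: the next update map is independent of everything up to now. -/
theorem noiseLaw_step (t : ℤ) {S : Set (ℤ → Fin 2 → Fin 2)}
    (hS : MeasurableSet[timesAlgebra (Set.Iic t)] S) {i : Fin 2}
    (hi : ∀ u ∈ S, coupled u t = i) (j : Fin 2) :
    noiseLaw p q (S ∩ {u | coupled u (t + 1) = j}) =
      noiseLaw p q S * ENNReal.ofReal (coinStep p q i j) := by
  -- On `S` the state is the fixed `i`, so the next state involves only the map at time `t + 1`.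
  have h : (S ∩ {u | coupled u (t + 1) = j} : Set _) =ᵐ[noiseLaw p q]
      (S ∩ {u | u (t + 1) ∈ {g : Fin 2 → Fin 2 | g i = j}} : Set _) := by
    filter_upwards [ae_coupled_step p q] with u hu
    refine propext (and_congr_right fun hus => ?_)
    have := hu (t + 1)
    rw [add_sub_cancel_right, hi u hus] at this
    change coupled u (t + 1) = j ↔ u (t + 1) i = j
    rw [this]
  have hT : MeasurableSet[timesAlgebra (Set.Ioi t)]
      {u | u (t + 1) ∈ {g : Fin 2 → Fin 2 | g i = j}} :=
    measurable_eval_timesAlgebra (Set.mem_Ioi.2 (lt_add_one t)) (Set.toFinite _).measurableSet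
  rw [measure_congr h, noiseLaw_inter p q (Set.Iic_disjoint_Ioi le_rfl) hS hT,
    noiseLaw_preimage_eval p q _ (Set.toFinite _).measurableSet, mapLaw_apply_eq]

theorem measurableSet_coupled_eq (t : ℤ) (i : Fin 2) :
    MeasurableSet[timesAlgebra (Set.Iic t)] {u | coupled u t = i} :=
  measurable_coupled_timesAlgebra subset_rfl (measurableSet_singleton i)

/-- Shift invariance makes the one-time law a fixed point of one step of the chain; since `p + q ≠
0`, the resulting linear equation has a single solution. -/
theorem noiseLaw_coupled_eq (t : ℤ) (i : Fin 2) :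
    noiseLaw p q {u | coupled u t = i} = ENNReal.ofReal (coinStationary p q i) := by
  have hm : ∀ t i, MeasurableSet {u : ℤ → Fin 2 → Fin 2 | coupled u t = i} := fun t i =>
    timesAlgebra_le _ _ (measurableSet_coupled_eq t i)
  set m := (noiseLaw p q).real {u | coupled u t = 1} with hmdef
  have h0 : (noiseLaw p q).real {u | coupled u t = 0} = 1 - m := by
    rw [hmdef, ← probReal_compl_eq_one_sub (hm t 1)]
    congr 1
    ext u
    simp only [Set.mem_ofPred_eq, Set.mem_compl_iff]
    omega
  have hstep : ∀ j, (noiseLaw p q).real ({u | coupled u t = j} ∩ {u | coupled u (t + 1) = 1}) =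
      (noiseLaw p q).real {u | coupled u t = j} * coinStep p q j 1 := fun j => by
    rw [measureReal_def, noiseLaw_step p q t (measurableSet_coupled_eq t j) (fun u hu => hu) 1,
      ENNReal.toReal_mul, ENNReal.toReal_ofReal (coinStep_nonneg p q j 1), measureReal_def]
  have hsum : m = (1 - m) * p + m * (1 - q) := by
    have h1 : m = (noiseLaw p q).real {u | coupled u (t + 1) = 1} := by
      rw [measureReal_def, noiseLaw_coupled_shift p q (t + 1), add_sub_cancel_right]
      rfl
    conv_lhs => rw [h1, ← measureReal_inter_add_sdiff (s := {u | coupled u (t + 1) = 1}) (hm t 0)]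
    have e1 : ({u | coupled u (t + 1) = 1} \ {u | coupled u t = 0} : Set (ℤ → Fin 2 → Fin 2)) =
        {u | coupled u t = 1} ∩ {u | coupled u (t + 1) = 1} := by
      ext u
      simp only [Set.mem_sdiff, Set.mem_inter_iff, Set.mem_ofPred_eq]
      omega
    rw [e1, Set.inter_comm, hstep, hstep, h0]
    simp [coinStep, hmdef]
  have hpos : p + q ≠ 0 := (add_pos hpq.p_pos hpq.q_pos).ne'
  have hm1 : m = p / (p + q) := by
    field_simp
    linarith
  rw [← ENNReal.ofReal_toReal (measure_ne_top (noiseLaw p q) _), ← measureReal_def]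
  congr 1
  fin_cases i
  · simp only [Fin.zero_eta, Fin.isValue, h0, hm1, coinStationary, if_true]
    field_simp
    ring
  · simp [coinStationary, ← hm1, hmdef]

theorem coinStationary_pos (i : Fin 2) : 0 < coinStationary p q i := by
  have := hpq.p_pos
  have := hpq.q_pos
  unfold coinStationary
  split_ifs <;> positivity

theorem measurableSet_coupled_word (t : ℤ) (n : ℕ) (w : Fin (n + 1) → Fin 2) :
    MeasurableSet[timesAlgebra (Set.Iic (t + n))]
      {u | ∀ i : Fin (n + 1), coupled u (t + (i : ℕ)) = w i} := by
  simp only [Set.ofPred_forall]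
  refine MeasurableSet.iInter fun i => measurable_coupled_timesAlgebra (t := t + (i : ℕ))
    (Set.Iic_subset_Iic.2 ?_) (measurableSet_singleton (w i))
  have := i.is_lt
  omega

theorem noiseLaw_coupled_word (t : ℤ) (n : ℕ) (w : Fin (n + 1) → Fin 2) :
    noiseLaw p q {u | ∀ i : Fin (n + 1), coupled u (t + (i : ℕ)) = w i} =
      ENNReal.ofReal
        (coinStationary p q (w 0) * ∏ i : Fin n, coinStep p q (w i.castSucc) (w i.succ)) := by
  induction n with
  | zero => simpa using noiseLaw_coupled_eq p q t (w 0)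
  | succ n ih =>
    have e : {u | ∀ i : Fin (n + 1 + 1), coupled u (t + (i : ℕ)) = w i} =
        {u | ∀ i : Fin (n + 1), coupled u (t + (i : ℕ)) = w i.castSucc} ∩
          {u | coupled u (t + n + 1) = w (Fin.last _)} := by
      ext u
      simp [Fin.forall_fin_succ', add_assoc]
    rw [e, noiseLaw_step p q (t + n) (measurableSet_coupled_word t n fun i => w i.castSucc)
      (fun u hu => hu (Fin.last n)), ih, Fin.prod_univ_castSucc,
      ← ENNReal.ofReal_mul (mul_nonneg (coinStationary_pos p q _).le
        (Finset.prod_nonneg fun i _ => coinStep_nonneg p q _ _)), mul_assoc]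
    rfl

/-- The perturbed coin. -/
def perturbedCoin : StationaryProcess (Fin 2) where
  law := (noiseLaw p q).map coupled
  isProbability := Measure.isProbabilityMeasure_map measurable_coupled.aemeasurable
  stationary := by
    have h : shift ∘ coupled = coupled ∘ shift := by
      funext u
      exact (coupled_shift u).symm
    rw [Measure.map_map measurable_shift measurable_coupled, h,
      ← Measure.map_map measurable_coupled measurable_shift, noiseLaw_map_shift]

theorem isPerturbedCoin_perturbedCoin : IsPerturbedCoin p q (perturbedCoin p q) := by
  intro t n w
  have hm : MeasurableSet {c : ℤ → Fin 2 | ∀ i : Fin (n + 1), c (t + (i : ℕ)) = w i} := by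
    simp only [Set.ofPred_forall]
    exact MeasurableSet.iInter fun i =>
      (measurable_pi_apply (t + (i : ℕ)) : Measurable fun c : ℤ → Fin 2 => c (t + (i : ℕ)))
        (measurableSet_singleton (w i))
  rw [← noiseLaw_coupled_word, perturbedCoin, Measure.map_apply measurable_coupled hm]
  rfl

variable {p q}

/-- The Markov property at time `0`: given the present state, the continuation is independent of
the history. -/
theorem IsPerturbedCoin.markov {C : StationaryProcess (Fin 2)} (hC : IsPerturbedCoin p q C)
    (j : Fin 2) : ∃ N : Measure (ℕ → Fin 2), IsProbabilityMeasure N ∧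
      ∀ S T : Set (ℕ → Fin 2), MeasurableSet S → MeasurableSet T →
        C.law {c | c 0 = j ∧ (fun n : ℕ => c (-(n : ℤ))) ∈ T ∧ (fun n : ℕ => c n) ∈ S} =
          C.law {c | c 0 = j ∧ (fun n : ℕ => c (-(n : ℤ))) ∈ T} * N S := by
  rw [hC.unique (isPerturbedCoin_perturbedCoin p q)]
  have hj : Measurable fun u => runAhead u j := (measurable_runAhead j).mono (timesAlgebra_le _)
    le_rfl
  -- The continuation from `j` uses only maps at positive times, while the history uses those at
  -- times at most `0`.
  refine ⟨(noiseLaw p q).map fun u => runAhead u j,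
    Measure.isProbabilityMeasure_map hj.aemeasurable, fun S T hS hT => ?_⟩
  have hm0 : Measurable fun c : ℤ → Fin 2 => c 0 := measurable_pi_apply 0
  have hmT : Measurable fun (c : ℤ → Fin 2) (n : ℕ) => c (-(n : ℤ)) :=
    measurable_pi_lambda _ fun _ => measurable_pi_apply _
  have hmS : Measurable fun (c : ℤ → Fin 2) (n : ℕ) => c n :=
    measurable_pi_lambda _ fun _ => measurable_pi_apply _
  have h0T : MeasurableSet {c : ℤ → Fin 2 | c 0 = j ∧ (fun n : ℕ => c (-(n : ℤ))) ∈ T} :=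
    (hm0 (measurableSet_singleton j)).inter (hmT hT)
  have h0TS : MeasurableSet {c : ℤ → Fin 2 | c 0 = j ∧ (fun n : ℕ => c (-(n : ℤ))) ∈ T ∧
      (fun n : ℕ => c n) ∈ S} :=
    (hm0 (measurableSet_singleton j)).inter ((hmT hT).inter (hmS hS))
  have hA : MeasurableSet[timesAlgebra (Set.Iic 0)]
      {u | coupled u 0 = j ∧ (fun n : ℕ => coupled u (-(n : ℤ))) ∈ T} := by
    refine @MeasurableSet.inter _ (timesAlgebra (Set.Iic 0)) _ _ (measurableSet_coupled_eq 0 j) ?_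
    refine @measurable_pi_lambda _ _ _ (timesAlgebra (Set.Iic 0)) _
      (fun (u : ℤ → Fin 2 → Fin 2) (n : ℕ) => coupled u (-(n : ℤ))) (fun n => ?_) T hT
    exact measurable_coupled_timesAlgebra (Set.Iic_subset_Iic.2 (by omega))
  have hae : {u | coupled u 0 = j ∧ (fun n : ℕ => coupled u (-(n : ℤ))) ∈ T ∧
      (fun n : ℕ => coupled u n) ∈ S} =ᵐ[noiseLaw p q]
      ({u | coupled u 0 = j ∧ (fun n : ℕ => coupled u (-(n : ℤ))) ∈ T} ∩
        (fun u => runAhead u j) ⁻¹' S : Set _) := by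
    filter_upwards [ae_coupled_runAhead p q] with u hu
    refine propext ?_
    change (_ ∧ _ ∧ _) ↔ ((_ ∧ _) ∧ _)
    rw [and_assoc]
    refine and_congr_right fun h0 => and_congr_right fun _ => ?_
    have : (fun n : ℕ => coupled u n) = runAhead u j := by
      funext n
      rw [hu n, h0]
    rw [this]
    rfl
  simp only [perturbedCoin]
  rw [Measure.map_apply measurable_coupled h0TS, Measure.map_apply measurable_coupled h0T,
    Measure.map_apply hj hS]
  refine (measure_congr hae).trans
    (noiseLaw_inter p q (Set.Iic_disjoint_Ioi le_rfl) hA (measurable_runAhead j hS))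

end Noise

/-! ### Futures that depend on the past through a finite statistic -/

/-- The hypothesis `hind` is conditional independence of `f` and `g` given `r ∘ f`, cleared of
denominators. The candidate kernel factors through the finite type `ι`, so its defining identity can
be checked on rectangles, one fibre of `r` at a time. -/
theorem condDistrib_ae_eq_cond {Ω X Z ι : Type*} [MeasurableSpace Ω] [MeasurableSpace X]
    [MeasurableSpace Z] [StandardBorelSpace Z] [Nonempty Z] [Fintype ι] [MeasurableSpace ι]
    [DiscreteMeasurableSpace ι] {μ : Measure Ω} [IsProbabilityMeasure μ] {f : Ω → X} {g : Ω → Z}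
    (hf : Measurable f) (hg : Measurable g) {r : X → ι} (hr : Measurable r)
    (h0 : ∀ i, μ {ω | r (f ω) = i} ≠ 0)
    (hind : ∀ i (S : Set X) (T : Set Z), MeasurableSet S → MeasurableSet T →
      μ {ω | r (f ω) = i ∧ f ω ∈ S ∧ g ω ∈ T} * μ {ω | r (f ω) = i} =
        μ {ω | r (f ω) = i ∧ f ω ∈ S} * μ {ω | r (f ω) = i ∧ g ω ∈ T}) :
    condDistrib g f μ =ᵐ[μ.map f] fun x => (μ[|{ω | r (f ω) = r x}]).map g := by
  have hrf : Measurable fun ω => r (f ω) := hr.comp hf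
  have hE : ∀ i, MeasurableSet {ω | r (f ω) = i} := fun i => hrf (measurableSet_singleton i)
  have hP : ∀ i, IsProbabilityMeasure ((μ[|{ω | r (f ω) = i}]).map g) := fun i => by
    have := cond_isProbabilityMeasure (h0 i)
    exact Measure.isProbabilityMeasure_map hg.aemeasurable
  let κ₀ : Kernel ι Z := ⟨fun i => (μ[|{ω | r (f ω) = i}]).map g, .of_discrete⟩
  have hκ₀ : IsMarkovKernel κ₀ := ⟨hP⟩
  let κ : Kernel X Z := κ₀.comap r hr
  have h : condDistrib g f μ =ᵐ[μ.map f] κ := by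
    refine condDistrib_ae_eq_of_measure_eq_compProd f hg.aemeasurable ?_
    have := Measure.isProbabilityMeasure_map (μ := μ) hf.aemeasurable
    have := Measure.isProbabilityMeasure_map (μ := μ) (hf.prodMk hg).aemeasurable
    refine Measure.ext_prod fun {S T} hS hT => ?_
    rw [Measure.compProd_apply_prod hS hT, Measure.map_apply (hf.prodMk hg) (hS.prod hT),
      setLIntegral_map hS (κ.measurable_coe hT) hf]
    have e1 : ∫⁻ ω in f ⁻¹' S, κ (f ω) T ∂μ =
        ∫⁻ i, κ₀ i T ∂(μ.restrict (f ⁻¹' S)).map fun ω => r (f ω) := by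
      rw [lintegral_map (κ₀.measurable_coe hT) hrf]
      rfl
    rw [e1, lintegral_fintype, ← Set.univ_inter ((fun ω => (f ω, g ω)) ⁻¹' S ×ˢ T),
      ← Set.preimage_univ (f := fun ω => r (f ω)), ← Finset.coe_univ,
      ← Measure.restrict_apply' (hf.prodMk hg (hS.prod hT)), ← sum_measure_preimage_singleton]
    · refine Finset.sum_congr rfl fun i _ => ?_
      rw [Measure.restrict_apply' (hf.prodMk hg (hS.prod hT)),
        Measure.map_apply hrf (measurableSet_singleton i),
        Measure.restrict_apply' (hf hS)]
      change μ {ω | r (f ω) = i ∧ f ω ∈ S ∧ g ω ∈ T} =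
        (μ[|{ω | r (f ω) = i}]).map g T * μ {ω | r (f ω) = i ∧ f ω ∈ S}
      rw [Measure.map_apply hg hT, cond_apply (hE i)]
      change _ = (μ {ω | r (f ω) = i})⁻¹ * μ {ω | r (f ω) = i ∧ g ω ∈ T} * _
      rw [mul_assoc, mul_comm (μ {ω | r (f ω) = i ∧ g ω ∈ T}), ← hind i S T hS hT, mul_comm,
        mul_assoc, ENNReal.mul_inv_cancel (h0 i) (measure_ne_top _ _), mul_one]
    · exact fun i _ => hrf (measurableSet_singleton i)
  exact h

theorem measurable_past {A : Type*} [MeasurableSpace A] : Measurable (past : (ℤ → A) → ℕ → A) :=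
  measurable_pi_lambda _ fun _ => measurable_pi_apply _

theorem measurable_future {A : Type*} [MeasurableSpace A] :
    Measurable (future : (ℤ → A) → ℕ → A) :=
  measurable_pi_lambda _ fun _ => measurable_pi_apply _

/-! ### Counting causal states and bounding the quantum dimension -/

section Models

variable {A : Type*} [Fintype A] [Nonempty A] [MeasurableSpace A] [DiscreteMeasurableSpace A]

/-- If the future depends on the past exactly through the last output, then the causal states
correspond to the outputs. -/
theorem numCausalStates_eq_card {P : StationaryProcess A} {K : A → Measure (ℕ → A)}
    (hK : Function.Injective K) (h : ∀ᵐ x ∂P.pastLaw, P.futureGivenPast x = K (x 0))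
    (h0 : ∀ a, P.pastLaw {x | x 0 = a} ≠ 0) : P.numCausalStates = Fintype.card A := by
  have hcard : (Set.range K).encard = Fintype.card A := by
    rw [← Set.image_univ, hK.encard_image, Set.encard_univ, ENat.card_eq_coe_fintype_card]
  -- Conditional futures separate causal states, so counting states is counting conditional laws.
  let φ : P.CausalState → Measure (ℕ → A) := Quotient.lift P.futureGivenPast fun _ _ h => h
  have hφ : Function.Injective φ := by
    rintro ⟨x⟩ ⟨y⟩ hxy
    exact Quotient.sound hxy
  have himage : ∀ S, (P.causalState '' S).encard = (P.futureGivenPast '' S).encard := fun S => by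
    rw [← hφ.encard_image, Set.image_image]
    rfl
  refine le_antisymm ((iInf₂_le {x | P.futureGivenPast x = K (x 0)} h).trans ?_)
    (le_iInf₂ fun S hS => ?_)
  · rw [himage, ← hcard]
    refine Set.encard_le_encard ?_
    rintro _ ⟨x, hx, rfl⟩
    exact ⟨x 0, hx.symm⟩
  · rw [himage, ← hcard]
    refine Set.encard_le_encard ?_
    rintro _ ⟨a, rfl⟩
    -- Pasts ending in `a` have positive mass, hence meet every set of full measure.
    have : ∃ᵐ x ∂P.pastLaw, x 0 = a := frequently_ae_iff.2 (h0 a)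
    obtain ⟨x, hxa, hxS, hx⟩ := (this.and_eventually (hS.and h)).exists
    exact ⟨x, hxS, by rw [hx, hxa]⟩

/-- In dimension at most one all unit vectors give the same projector, so the output probabilities
could not distinguish pasts. -/
theorem two_le_of_quantumModel {P : StationaryProcess A} {d : ℕ} (M : QuantumModel P d) {c : A}
    {v w : ℝ} (hvw : v ≠ w) (hv : ∃ᵐ x ∂P.pastLaw, P.nextProb x c = v)
    (hw : ∃ᵐ x ∂P.pastLaw, P.nextProb x c = w) : 2 ≤ d := by
  by_contra! hd
  obtain ⟨x, hx, hxM⟩ := (hv.and_eventually M.output).exists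
  obtain ⟨y, hy, hyM⟩ := (hw.and_eventually M.output).exists
  have hket : ketbra (M.encode x) = ketbra (M.encode y) := by
    have hn : ∀ z, ∀ i j : Fin d, ketbra (M.encode z) i j = 1 := fun z i j => by
      have : Subsingleton (Fin d) := Fin.subsingleton_iff_le_one.2 (by omega)
      have h := M.norm_encode z
      rw [EuclideanSpace.norm_eq, Real.sqrt_eq_one, Fintype.sum_subsingleton _ j] at h
      rw [ketbra, Matrix.of_apply, Subsingleton.elim i j, Complex.mul_conj, Complex.normSq_eq_norm_sq,
        h, Complex.ofReal_one]
    ext i j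
    rw [hn, hn]
  have h := hxM c
  rw [hket, hyM c, hx, hy] at h
  exact hvw (by exact_mod_cast h.symm)

/-- The law of the future given that the last output was `a`. -/
def StationaryProcess.futureGivenLast (P : StationaryProcess A) (a : A) : Measure (ℕ → A) :=
  (P.law[|{x | past x 0 = a}]).map future

end Models

/-! ### The reversed heralding coin -/

/-- The output of the heralding coin when the coin shows `a` after `b`. -/
def heraldSymbol (a b : Fin 2) : Fin 3 := if a = 1 then 1 else if b = 1 then 2 else 0

/-- The state of the coin that underlies an output of the heralding coin. -/
def heraldState (i : Fin 3) : Fin 2 := if i = 1 then 1 else 0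

theorem eq_heraldState {a b : Fin 2} {i : Fin 3} (h : heraldSymbol a b = i) :
    a = heraldState i := by
  subst h
  revert a b
  decide

theorem past_reversal_heraldMap (c : ℤ → Fin 2) (n : ℕ) :
    past (reversal (heraldMap c)) n = heraldSymbol (c n) (c ((n : ℤ) - 1)) := by
  have h : -(-((n : ℤ) + 1) + 1) = n := by ring
  simp only [past, reversal, h]
  rfl

theorem future_reversal_heraldMap (c : ℤ → Fin 2) (n : ℕ) :
    future (reversal (heraldMap c)) n =
      heraldSymbol (c (-((n + 1 : ℕ) : ℤ))) (c (-((n + 2 : ℕ) : ℤ))) := by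
  have h1 : -((n + 1 : ℕ) : ℤ) = -((n : ℤ) + 1) := by push_cast; ring
  have h2 : -((n + 2 : ℕ) : ℤ) = -((n : ℤ) + 1) - 1 := by push_cast; ring
  rw [h1, h2]
  rfl

theorem reverse_herald_law_apply (C : StationaryProcess (Fin 2)) {S : Set (ℤ → Fin 3)}
    (hS : MeasurableSet S) :
    (herald C).reverse.law S = C.law {c | reversal (heraldMap c) ∈ S} := by
  change ((C.law.map heraldMap).map reversal) S = _
  rw [Measure.map_map measurable_reversal measurable_heraldMap,
    Measure.map_apply (measurable_reversal.comp measurable_heraldMap) hS]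
  rfl

/-- The outputs of the reversed heralding coin before time `0`, the last of which is `i`, in terms
of the coin from time `0` on. -/
def heraldAhead (i : Fin 3) (f : ℕ → Fin 2) : ℕ → Fin 3
  | 0 => i
  | n + 1 => heraldSymbol (f (n + 1)) (f n)

/-- The outputs of the reversed heralding coin in terms of the coin up to time `0`. -/
def heraldBack (f : ℕ → Fin 2) : ℕ → Fin 3 := fun n => heraldSymbol (f n) (f (n + 1))

theorem measurable_heraldSymbol {Ω : Type*} [MeasurableSpace Ω] {f g : Ω → Fin 2}
    (hf : Measurable f) (hg : Measurable g) : Measurable fun ω => heraldSymbol (f ω) (g ω) :=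
  (Measurable.of_discrete (f := fun z : Fin 2 × Fin 2 => heraldSymbol z.1 z.2)).comp
    (hf.prodMk hg)

theorem measurable_heraldAhead (i : Fin 3) : Measurable (heraldAhead i) := by
  refine measurable_pi_lambda _ fun n => ?_
  cases n with
  | zero => exact measurable_const
  | succ n => exact measurable_heraldSymbol (measurable_pi_apply _) (measurable_pi_apply _)

theorem measurable_heraldBack : Measurable heraldBack :=
  measurable_pi_lambda _ fun n =>
    measurable_heraldSymbol (measurable_pi_apply n) (measurable_pi_apply (n + 1))

/-- Only the most recent output depends on the coin at time `-1`; fixing it to be `i` leaves a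
function of the coin from time `0` on. -/
theorem past_reversal_heraldMap_eq {c : ℤ → Fin 2} {i : Fin 3}
    (h : past (reversal (heraldMap c)) 0 = i) :
    past (reversal (heraldMap c)) = heraldAhead i fun n => c n := by
  funext n
  cases n with
  | zero => exact h
  | succ n =>
    rw [past_reversal_heraldMap]
    simp [heraldAhead]

theorem future_reversal_heraldMap_eq (c : ℤ → Fin 2) :
    future (reversal (heraldMap c)) = fun n => heraldBack (fun n => c (-(n : ℤ))) (n + 1) := by
  funext n
  rw [future_reversal_heraldMap]
  rfl

theorem past_reversal_heraldMap_zero (c : ℤ → Fin 2) :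
    past (reversal (heraldMap c)) 0 = heraldBack (fun n => c (-(n : ℤ))) 0 := by
  rw [past_reversal_heraldMap]
  rfl

theorem measurableSet_apply_eq {A : Type*} [MeasurableSpace A] [DiscreteMeasurableSpace A] (n : ℕ)
    (a : A) : MeasurableSet {x : ℕ → A | x n = a} :=
  (measurable_pi_apply n : Measurable fun x : ℕ → A => x n) (measurableSet_singleton a)

/-- The distribution of one output of the heralding coin. -/
def heraldStationary (p q : ℝ) : Fin 3 → ℝ :=
  ![q * (1 - p) / (p + q), p / (p + q), p * q / (p + q)]

/-- The transition probabilities of the reversed heralding coin. -/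
def reverseStep (p q : ℝ) : Fin 3 → Fin 3 → ℝ :=
  ![![1 - p, 0, p], ![q * (1 - p), 1 - q, p * q], ![0, 1, 0]]

theorem pastLaw_apply (P : StationaryProcess (Fin 3)) (i : Fin 3) :
    P.pastLaw {x | x 0 = i} = P.law {y | past y 0 = i} :=
  Measure.map_apply measurable_past (measurableSet_apply_eq 0 i)

/-! ### The quantum model on a qubit -/

/-- The qubit state that encodes the pasts of the reversed heralding coin with last output `i`. -/
def qubitState (q : ℝ) : Fin 3 → EuclideanSpace ℂ (Fin 2) :=
  ![!₂[1, 0], !₂[(√q : ℂ), (√(1 - q) : ℂ)], !₂[0, 1]]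

/-- The Kraus operators of the measurement of the qubit. -/
def qubitKraus (p q : ℝ) : Fin 3 → Matrix (Fin 2) (Fin 2) ℂ :=
  ![!![(√(1 - p) : ℂ), 0; 0, 0], !![0, (√q : ℂ); 0, (√(1 - q) : ℂ)], !![0, 0; (√p : ℂ), 0]]

/-- The transition amplitudes of the qubit model. -/
def qubitAmplitude (p q : ℝ) : Fin 3 → Fin 3 → ℝ :=
  ![![√(1 - p), 0, √p], ![√q * √(1 - p), √(1 - q), √p * √q], ![0, 1, 0]]

theorem norm_qubitState {q : ℝ} (hq0 : 0 ≤ q) (hq1 : q ≤ 1) (i : Fin 3) :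
    ‖qubitState q i‖ = 1 := by
  rw [EuclideanSpace.norm_eq, Real.sqrt_eq_one, Fin.sum_univ_two]
  fin_cases i <;> simp [qubitState, Real.sq_sqrt, hq0, hq1]

/-- Each Kraus operator has rank one with range spanned by the state of its own outcome, so the
updated state depends on the outcome alone. -/
theorem qubitKraus_mulVec (p q : ℝ) (i a : Fin 3) (k : Fin 2) :
    (qubitKraus p q a).mulVec (qubitState q i) k = qubitAmplitude p q i a * qubitState q a k := by
  fin_cases i <;> fin_cases a <;> fin_cases k <;>
    simp [qubitKraus, qubitState, qubitAmplitude, Matrix.mulVec, dotProduct, Fin.sum_univ_two] <;>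
    ring

theorem mul_ketbra_mul_conjTranspose {d : ℕ} (K : Matrix (Fin d) (Fin d) ℂ)
    {ψ φ : EuclideanSpace ℂ (Fin d)} {r : ℝ} (h : ∀ k, K.mulVec ψ k = r * φ k) :
    K * ketbra ψ * K.conjTranspose = ((r ^ 2 : ℝ) : ℂ) • ketbra φ := by
  have e : ∀ χ : EuclideanSpace ℂ (Fin d), ketbra χ = Matrix.vecMulVec χ (star (χ : Fin d → ℂ)) :=
    fun χ => rfl
  have hK : K.mulVec ψ = (r : ℂ) • (φ : Fin d → ℂ) := funext h
  rw [e, e, Matrix.mul_vecMulVec, Matrix.vecMulVec_mul, ← Matrix.star_mulVec, hK]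
  ext i j
  simp [Matrix.vecMulVec_apply]
  ring

theorem trace_ketbra {d : ℕ} {ψ : EuclideanSpace ℂ (Fin d)} (h : ‖ψ‖ = 1) :
    (ketbra ψ).trace = 1 := by
  rw [EuclideanSpace.norm_eq, Real.sqrt_eq_one] at h
  simp only [Matrix.trace, Matrix.diag, ketbra, Matrix.of_apply, Complex.mul_conj,
    Complex.normSq_eq_norm_sq]
  exact_mod_cast h

/-! ### The reversed heralding coin: Markov property, causal states, qubit model -/

section Reverse

variable {p q : ℝ} [hpq : IsNondegenerate p q] {C : StationaryProcess (Fin 2)}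

/-- The output `i` reveals the coin at time `0`, so the Markov property of the coin applies, with
past and future exchanged by the reversal. -/
theorem IsPerturbedCoin.reverse_herald_markov (hC : IsPerturbedCoin p q C) (i : Fin 3) :
    ∃ N : Measure (ℕ → Fin 3), IsProbabilityMeasure N ∧
      ∀ S T : Set (ℕ → Fin 3), MeasurableSet S → MeasurableSet T →
        (herald C).reverse.law {y | past y 0 = i ∧ past y ∈ S ∧ future y ∈ T} =
          (herald C).reverse.law {y | past y 0 = i ∧ future y ∈ T} * N S := by
  obtain ⟨N, hN, h⟩ := hC.markov (heraldState i)
  have hm0 : Measurable fun y : ℤ → Fin 3 => past y 0 := measurable_pi_apply _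
  refine ⟨N.map (heraldAhead i),
    Measure.isProbabilityMeasure_map (measurable_heraldAhead i).aemeasurable, fun S T hS hT => ?_⟩
  have hET : MeasurableSet {y : ℤ → Fin 3 | past y 0 = i ∧ future y ∈ T} :=
    (hm0 (measurableSet_singleton i)).inter (measurable_future hT)
  have hEST : MeasurableSet {y : ℤ → Fin 3 | past y 0 = i ∧ past y ∈ S ∧ future y ∈ T} :=
    (hm0 (measurableSet_singleton i)).inter ((measurable_past hS).inter (measurable_future hT))
  rw [reverse_herald_law_apply C hET, reverse_herald_law_apply C hEST,
    Measure.map_apply (measurable_heraldAhead i) hS]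
  -- The condition that the last output is `i` looks at times `0` and `-1`, so it is counted as part
  -- of the coin's history.
  have hT' : MeasurableSet {f | heraldBack f 0 = i ∧ (fun n => heraldBack f (n + 1)) ∈ T} := by
    refine ((measurable_pi_apply 0).comp measurable_heraldBack (measurableSet_singleton i)).inter ?_
    exact (measurable_pi_lambda _ fun n => (measurable_pi_apply (n + 1)).comp
      measurable_heraldBack : Measurable fun f n => heraldBack f (n + 1)) hT
  have key := h _ _ (measurable_heraldAhead i hS) hT'
  convert key using 2
  · congr 1
    ext c
    change (_ ∧ _ ∧ _) ↔ (_ ∧ (_ ∧ _) ∧ _)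
    rw [future_reversal_heraldMap_eq, past_reversal_heraldMap_zero]
    constructor
    · rintro ⟨h0, h1, h2⟩
      refine ⟨eq_heraldState h0, ⟨h0, h2⟩, ?_⟩
      rwa [past_reversal_heraldMap_eq ((past_reversal_heraldMap_zero c).trans h0)] at h1
    · rintro ⟨-, ⟨h0, h2⟩, h1⟩
      refine ⟨h0, ?_, h2⟩
      rwa [past_reversal_heraldMap_eq ((past_reversal_heraldMap_zero c).trans h0)]
  · congr 1
    ext c
    change (_ ∧ _) ↔ (_ ∧ (_ ∧ _))
    rw [future_reversal_heraldMap_eq, past_reversal_heraldMap_zero]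
    exact ⟨fun h => ⟨eq_heraldState h.1, h⟩, fun h => h.2⟩

theorem IsPerturbedCoin.word_three (hC : IsPerturbedCoin p q C) (z : Fin 2 × Fin 2 × Fin 2) :
    C.law.real {c | (c (-2), c (-1), c 0) = z} =
      coinStationary p q z.1 * (coinStep p q z.1 z.2.1 * coinStep p q z.2.1 z.2.2) := by
  have h := hC (-2) 2 ![z.1, z.2.1, z.2.2]
  have e : {c : ℤ → Fin 2 | (c (-2), c (-1), c 0) = z} =
      {c | ∀ i : Fin (2 + 1), c (-2 + (i : ℕ)) = ![z.1, z.2.1, z.2.2] i} := by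
    ext c
    simp [Fin.forall_fin_succ, Prod.ext_iff]
  rw [measureReal_def, e, h, ENNReal.toReal_ofReal]
  · simp [Fin.prod_univ_two]
  · exact mul_nonneg (coinStationary_pos p q _).le
      (Finset.prod_nonneg fun i _ => coinStep_nonneg p q _ _)

/-- Two consecutive heralding outputs are determined by three coin symbols, so their joint law is a
finite sum over words of length three. -/
theorem IsPerturbedCoin.law_real_three (hC : IsPerturbedCoin p q C)
    (R : Fin 2 × Fin 2 × Fin 2 → Prop) [DecidablePred R] :
    C.law.real {c | R (c (-2), c (-1), c 0)} =
      ∑ z : Fin 2 × Fin 2 × Fin 2, if R z then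
        coinStationary p q z.1 * (coinStep p q z.1 z.2.1 * coinStep p q z.2.1 z.2.2) else 0 := by
  have hm : Measurable fun c : ℤ → Fin 2 => (c (-2), c (-1), c 0) := by fun_prop
  have h := sum_measureReal_preimage_singleton (μ := C.law)
    (f := fun c : ℤ → Fin 2 => (c (-2), c (-1), c 0)) (Finset.univ.filter R)
    fun z _ => hm (measurableSet_singleton z)
  rw [← Finset.sum_filter]
  refine Eq.trans ?_ (h.symm.trans (Finset.sum_congr rfl fun z _ => hC.word_three z))
  congr 1
  ext c
  simp

theorem heraldStationary_pos (i : Fin 3) : 0 < heraldStationary p q i := by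
  have := hpq.p_pos
  have := hpq.q_pos
  have := sub_pos.2 hpq.p_lt
  fin_cases i <;> simp [heraldStationary] <;> positivity

theorem IsPerturbedCoin.reverse_herald_last (hC : IsPerturbedCoin p q C) (i : Fin 3) :
    (herald C).reverse.law.real {y | past y 0 = i} = heraldStationary p q i := by
  have hm : MeasurableSet {y : ℤ → Fin 3 | past y 0 = i} :=
    (measurable_pi_apply _).comp measurable_past (measurableSet_singleton i)
  have h := hC.law_real_three fun z => heraldSymbol z.2.2 z.2.1 = i
  have hpos : p + q ≠ 0 := (add_pos hpq.p_pos hpq.q_pos).ne'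
  rw [measureReal_def, reverse_herald_law_apply C hm, ← measureReal_def]
  refine h.trans ?_
  simp only [Fintype.sum_prod_type, Fin.sum_univ_two]
  fin_cases i <;>
    simp [heraldSymbol, heraldStationary, coinStationary, coinStep] <;> field_simp <;> ring

theorem IsPerturbedCoin.reverse_herald_pair (hC : IsPerturbedCoin p q C) (i a : Fin 3) :
    (herald C).reverse.law.real {y | past y 0 = i ∧ future y 0 = a} =
      heraldStationary p q i * reverseStep p q i a := by
  have hm : MeasurableSet {y : ℤ → Fin 3 | past y 0 = i ∧ future y 0 = a} :=
    ((measurable_pi_apply _).comp measurable_past (measurableSet_singleton i)).inter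
      ((measurable_pi_apply _).comp measurable_future (measurableSet_singleton a))
  have h := hC.law_real_three fun z => heraldSymbol z.2.2 z.2.1 = i ∧ heraldSymbol z.2.1 z.1 = a
  have hpos : p + q ≠ 0 := (add_pos hpq.p_pos hpq.q_pos).ne'
  rw [measureReal_def, reverse_herald_law_apply C hm, ← measureReal_def]
  refine h.trans ?_
  simp only [Fintype.sum_prod_type, Fin.sum_univ_two]
  fin_cases i <;> fin_cases a <;>
    simp [-mul_eq_mul_left_iff, -mul_eq_mul_right_iff, heraldSymbol, heraldStationary,
      coinStationary, coinStep, reverseStep] <;>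
    field_simp <;> ring

theorem IsPerturbedCoin.reverse_herald_last_ne_zero (hC : IsPerturbedCoin p q C) (i : Fin 3) :
    (herald C).reverse.law {y | past y 0 = i} ≠ 0 := fun h => by
  have := hC.reverse_herald_last i
  rw [measureReal_def, h] at this
  exact (heraldStationary_pos i).ne this

theorem IsPerturbedCoin.futureGivenPast_ae_eq (hC : IsPerturbedCoin p q C) :
    ∀ᵐ x ∂(herald C).reverse.pastLaw, (herald C).reverse.futureGivenPast x =
      (herald C).reverse.futureGivenLast (x 0) := by
  have hr : Measurable fun x : ℕ → Fin 3 => x 0 := measurable_pi_apply 0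
  refine condDistrib_ae_eq_cond (r := fun x : ℕ → Fin 3 => x 0) measurable_past measurable_future hr
    hC.reverse_herald_last_ne_zero fun i S T hS hT => ?_
  obtain ⟨N, hN, h⟩ := hC.reverse_herald_markov i
  have h1 := h S T hS hT
  -- Taking the trivial future event identifies the factor `N S`, so both sides of `hind` become the
  -- same product.
  have h2 := h S Set.univ hS .univ
  simp only [Set.mem_univ, and_true] at h2
  rw [h1, h2]
  ring

theorem IsPerturbedCoin.futureGivenLast_real (hC : IsPerturbedCoin p q C) (i a : Fin 3) :
    ((herald C).reverse.futureGivenLast i).real {y | y 0 = a} = reverseStep p q i a := by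
  have hE : MeasurableSet {y : ℤ → Fin 3 | past y 0 = i} :=
    (measurable_pi_apply _).comp measurable_past (measurableSet_singleton i)
  have ha : MeasurableSet {y : ℕ → Fin 3 | y 0 = a} :=
    measurableSet_apply_eq 0 a
  rw [StationaryProcess.futureGivenLast, map_measureReal_apply measurable_future ha,
    measureReal_def, cond_apply hE, ENNReal.toReal_mul, ENNReal.toReal_inv, ← measureReal_def,
    ← measureReal_def, hC.reverse_herald_last i]
  refine (congrArg _ (hC.reverse_herald_pair i a)).trans ?_
  rw [inv_mul_cancel_left₀ (heraldStationary_pos i).ne']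

theorem IsPerturbedCoin.nextProb_ae_eq (hC : IsPerturbedCoin p q C) :
    ∀ᵐ x ∂(herald C).reverse.pastLaw, ∀ a,
      (herald C).reverse.nextProb x a = reverseStep p q (x 0) a := by
  filter_upwards [hC.futureGivenPast_ae_eq] with x hx a
  rw [StationaryProcess.nextProb, hx, hC.futureGivenLast_real]

theorem IsPerturbedCoin.futureGivenLast_injective (hC : IsPerturbedCoin p q C) :
    Function.Injective (herald C).reverse.futureGivenLast := by
  intro i j hij
  -- Output `1` alone separates the three laws: its probabilities are `0`, `1 - q` and `1`.
  have h : reverseStep p q i 1 = reverseStep p q j 1 := by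
    rw [← hC.futureGivenLast_real, ← hC.futureGivenLast_real, hij]
  have := hpq.q_pos
  have := hpq.q_lt
  fin_cases i <;> fin_cases j <;> simp [reverseStep] at h ⊢ <;> linarith

theorem IsPerturbedCoin.numCausalStates_reverse_herald (hC : IsPerturbedCoin p q C) :
    (herald C).reverse.numCausalStates = 3 :=
  numCausalStates_eq_card hC.futureGivenLast_injective hC.futureGivenPast_ae_eq fun i => by
    rw [pastLaw_apply]
    exact hC.reverse_herald_last_ne_zero i

theorem sq_qubitAmplitude (i a : Fin 3) : qubitAmplitude p q i a ^ 2 = reverseStep p q i a := by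
  have h1 := Real.sq_sqrt hpq.p_pos.le
  have h2 := Real.sq_sqrt hpq.q_pos.le
  have h3 := Real.sq_sqrt (sub_pos.2 hpq.p_lt).le
  have h4 := Real.sq_sqrt (sub_pos.2 hpq.q_lt).le
  fin_cases i <;> fin_cases a <;> simp [qubitAmplitude, reverseStep, mul_pow, *]

/-- The measurement of the qubit. -/
def qubitInstrument (p q : ℝ) [hpq : IsNondegenerate p q] : QuantumInstrument (Fin 3) 2 where
  r := 1
  kraus a _ := qubitKraus p q a
  complete := by
    have h1 : ((√p : ℝ) : ℂ) * √p = p := by exact_mod_cast Real.mul_self_sqrt hpq.p_pos.le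
    have h2 : ((√q : ℝ) : ℂ) * √q = q := by exact_mod_cast Real.mul_self_sqrt hpq.q_pos.le
    have h3 : ((√(1 - p) : ℝ) : ℂ) * √(1 - p) = 1 - p := by
      exact_mod_cast Real.mul_self_sqrt (sub_pos.2 hpq.p_lt).le
    have h4 : ((√(1 - q) : ℝ) : ℂ) * √(1 - q) = 1 - q := by
      exact_mod_cast Real.mul_self_sqrt (sub_pos.2 hpq.q_lt).le
    ext i j
    fin_cases i <;> fin_cases j <;>
      simp [Fin.sum_univ_three, qubitKraus, Matrix.mul_apply, Fin.sum_univ_two, h1, h2, h3, h4]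

theorem qubitInstrument_apply (i a : Fin 3) :
    (qubitInstrument p q).apply a (ketbra (qubitState q i)) =
      (reverseStep p q i a : ℂ) • ketbra (qubitState q a) := by
  rw [← sq_qubitAmplitude, ← mul_ketbra_mul_conjTranspose _ (qubitKraus_mulVec p q i a)]
  exact Fin.sum_univ_one _

theorem trace_qubitInstrument_apply (i a : Fin 3) :
    ((qubitInstrument p q).apply a (ketbra (qubitState q i))).trace = reverseStep p q i a := by
  rw [qubitInstrument_apply, Matrix.trace_smul,
    trace_ketbra (norm_qubitState hpq.q_pos.le hpq.q_lt.le a), smul_eq_mul, mul_one]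

/-- The quantum model of the reversed heralding coin on a qubit. -/
def IsPerturbedCoin.qubitModel (hC : IsPerturbedCoin p q C) :
    QuantumModel (herald C).reverse 2 where
  encode x := qubitState q (x 0)
  measurable_encode := (Measurable.of_discrete (f := qubitState q)).comp (measurable_pi_apply 0)
  norm_encode x := norm_qubitState hpq.q_pos.le hpq.q_lt.le (x 0)
  measurement := qubitInstrument p q
  output := by
    filter_upwards [hC.nextProb_ae_eq] with x hx a
    rw [hx, trace_qubitInstrument_apply]
  update := Filter.Eventually.of_forall fun x a => by
    rw [trace_qubitInstrument_apply, qubitInstrument_apply]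
    rfl

theorem IsPerturbedCoin.minQuantumDim_reverse_herald (hC : IsPerturbedCoin p q C) :
    (herald C).reverse.minQuantumDim = 2 := by
  refine le_antisymm (iInf₂_le 2 ⟨hC.qubitModel⟩) (le_iInf₂ fun d ⟨M⟩ => ?_)
  have h : ∀ i, ∃ᵐ x ∂(herald C).reverse.pastLaw,
      (herald C).reverse.nextProb x 1 = reverseStep p q i 1 := fun i => by
    have hi : ∃ᵐ x ∂(herald C).reverse.pastLaw, x 0 = i :=
      frequently_ae_iff.2 ((pastLaw_apply _ i).trans_ne (hC.reverse_herald_last_ne_zero i))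
    exact (hi.and_eventually hC.nextProb_ae_eq).mono fun x hx => hx.1 ▸ hx.2 1
  -- Output `1` is impossible after `0` and certain after `2`.
  have h2 : 2 ≤ d := two_le_of_quantumModel M (by simp [reverseStep]) (h 0) (h 2)
  exact_mod_cast h2

end Reverse

theorem log_ofNat (n : ℕ) [n.AtLeastTwo] :
    ENNReal.log (((OfNat.ofNat n : ℕ∞) : ℝ≥0∞)) = ((Real.log (OfNat.ofNat n) : ℝ) : EReal) := by
  have h : (((OfNat.ofNat n : ℕ∞)) : ℝ≥0∞) = ENNReal.ofReal (OfNat.ofNat n) := by simp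
  rw [h, ENNReal.log_ofReal_of_pos (by simp)]

end CausalModelling

end

theorem mainTheorem7 (p q : ℝ) (hp0 : 0 < p) (hp1 : p < 1) (hq0 : 0 < q) (hq1 : q < 1) :
    (∃! C : CausalModelling.StationaryProcess (Fin 2), CausalModelling.IsPerturbedCoin p q C) ∧
    ∀ C : CausalModelling.StationaryProcess (Fin 2), CausalModelling.IsPerturbedCoin p q C →
      (CausalModelling.herald C).reverse.numCausalStates = 3 ∧
      Nonempty (CausalModelling.QuantumModel (CausalModelling.herald C).reverse 2) ∧
      (CausalModelling.herald C).reverse.topologicalComplexity = ((Real.log 3 : ℝ) : EReal) ∧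
      (CausalModelling.herald C).reverse.quantumTopologicalComplexity =
        ((Real.log 2 : ℝ) : EReal) ∧
      (CausalModelling.herald C).reverse.quantumTopologicalComplexity <
        (CausalModelling.herald C).reverse.topologicalComplexity := by
  have hpq : CausalModelling.IsNondegenerate p q := ⟨hp0, hp1, hq0, hq1⟩
  refine ⟨⟨_, CausalModelling.isPerturbedCoin_perturbedCoin p q, fun D hD =>
    hD.unique (CausalModelling.isPerturbedCoin_perturbedCoin p q)⟩, fun C hC => ?_⟩
  have hμ : (CausalModelling.herald C).reverse.topologicalComplexity =
      ((Real.log 3 : ℝ) : EReal) := by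
    rw [CausalModelling.StationaryProcess.topologicalComplexity, hC.numCausalStates_reverse_herald,
      CausalModelling.log_ofNat]
  have hq : (CausalModelling.herald C).reverse.quantumTopologicalComplexity =
      ((Real.log 2 : ℝ) : EReal) := by
    rw [CausalModelling.StationaryProcess.quantumTopologicalComplexity,
      hC.minQuantumDim_reverse_herald, CausalModelling.log_ofNat]
  refine ⟨hC.numCausalStates_reverse_herald, ⟨hC.qubitModel⟩, hμ, hq, ?_⟩
  rw [hμ, hq]
  exact EReal.coe_lt_coe_iff.2 (Real.log_lt_log (by norm_num) (by norm_num))
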